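/- Let $d\ge 2$ and let $P\subset\mathbb{R}^n$ be a $d$-polytope, i.e. the convex hull of finitely many points whose affine hull has dimension $d$. A face of $P$ is $P$ itself or the intersection of $P$ with a hyperplane that contains $P$ in one of its closed halfspaces. Let $G(P)$ be the graph of $P$, whose vertices and edges are the $0$-dimensional and $1$-dimensional faces of $P$. An even subgraph of $G(P)$ is a spanning subgraph in which every vertex has even degree; a cycle of $G(P)$ is regarded as a spanning subgraph by adding the remaining vertices as isolated vertices. A facial cycle is a cycle of $G(P)$ that bounds a $2$-dimensional face $F$ of $P$, that is, whose edges are exactly the edges of $F$. The symmetric difference of spanning subgraphs is the spanning subgraph whose edge set is the symmetric difference of their edge sets. Then every even subgraph of $G(P)$ is the symmetric difference of finitely many facial cycles (the edgeless spanning subgraph being the symmetric difference of none). In particular, every cycle of $G(P)$ is the symmetric difference of finitely many facial cycles. -/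

import Mathlib

open scoped symmDiff

namespace Polytope

section

variable {E : Type*} [AddCommGroup E] [Module ℝ E]

/-- A (convex) polytope: the convex hull of a finite set of points. -/
def IsPolytope (P : Set E) : Prop :=
  ∃ X : Set E, X.Finite ∧ P = convexHull ℝ X

/-- `P` is nonempty and its affine hull has dimension `d`; equivalently, for `P` in a
finite-dimensional space, the maximum number of affinely independent points of `P` is `d + 1`.
(Nonemptiness is required since the empty set has dimension `-1`, not `0`.) -/
def HasDim (P : Set E) (d : ℕ) : Prop :=
  P.Nonempty ∧ Module.finrank ℝ (vectorSpan ℝ P) = d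

/-- `F` is a face of `P`: it is `P` itself, or the intersection of `P` with a hyperplane
`{x | l x = a}` (where `l ≠ 0`) such that `P` lies in the closed halfspace `{x | l x ≤ a}`. -/
def IsFace (P F : Set E) : Prop :=
  F = P ∨ ∃ (l : E →ₗ[ℝ] ℝ) (a : ℝ), l ≠ 0 ∧ (∀ x ∈ P, l x ≤ a) ∧ F = P ∩ {x | l x = a}

/-- The vertices of `P`: the points `v` such that `{v}` is a face of `P`. -/
def vertices (P : Set E) : Set E :=
  {v | IsFace P {v}}

/-- `v` and `w` are the two ends of an edge of `P`: they are distinct vertices of `P` that lie on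
a common face of dimension `1`. -/
def JoinedByEdge (P : Set E) (v w : E) : Prop :=
  v ≠ w ∧ v ∈ vertices P ∧ w ∈ vertices P ∧ ∃ e : Set E, IsFace P e ∧ HasDim e 1 ∧ v ∈ e ∧ w ∈ e

/-- The graph of `P`, on the vertices of `P`, with an edge for every `1`-dimensional face. -/
def graph (P : Set E) : SimpleGraph (vertices P) where
  Adj v w := JoinedByEdge P v w
  symm := ⟨fun _ _ ⟨hne, hv, hw, e, he, hd, hve, hwe⟩ => ⟨hne.symm, hw, hv, e, he, hd, hwe, hve⟩⟩
  loopless := ⟨fun _ h => h.1 rfl⟩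

end

/-- `H` is an even subgraph of `G`: a spanning subgraph of `G` in which every vertex has even
degree. (Spanning subgraphs of `G : SimpleGraph V` are the `H : SimpleGraph V` with `H ≤ G`.) -/
def IsEvenSubgraph {V : Type*} (G H : SimpleGraph V) : Prop :=
  H ≤ G ∧ ∀ v, Even (H.neighborSet v).ncard

/-- `C` is a cycle of `G`, regarded as a spanning subgraph by adding isolated vertices. -/
def IsCycleOf {V : Type*} (G C : SimpleGraph V) : Prop :=
  ∃ (u : V) (p : G.Walk u u), p.IsCycle ∧ C = p.toSubgraph.spanningCoe

/-- `C` is a facial cycle of `P`: a cycle of the graph of `P` that bounds a `2`-face `F` of `P`,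
i.e. whose edges are exactly the edges of `F`. -/
def IsFacialCycle {E : Type*} [AddCommGroup E] [Module ℝ E] (P : Set E)
    (C : SimpleGraph (vertices P)) : Prop :=
  IsCycleOf (graph P) C ∧
    ∃ F : Set E, IsFace P F ∧ HasDim F 2 ∧ ∀ v w : vertices P, C.Adj v w ↔ JoinedByEdge F v w

/-- `H` is the symmetric difference `C₁ ∆ C₂ ∆ ⋯ ∆ Cₖ` of finitely many facial cycles of `P`
(the edgeless spanning subgraph being the symmetric difference of no cycles). -/
def IsSymmDiffOfFacialCycles {E : Type*} [AddCommGroup E] [Module ℝ E] (P : Set E)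
    (H : SimpleGraph (vertices P)) : Prop :=
  ∃ L : List (SimpleGraph (vertices P)),
    (∀ C ∈ L, IsFacialCycle P C) ∧ H = L.foldr (fun A B => A ∆ B) ⊥

end Polytope

/-! Sweep the polytope from the top with a generic linear functional `l`. For each vertex `v` fix a
functional `h v` maximal on `P` at `v` only, and order the descending edges `[v, w]` (those with `l
w < l v`) lexicographically by `l v` and then by `slope l (h v) v w`.

Let `H` be a nonempty even subgraph and `[v, w]` its largest descending edge. By parity `H` has a
second edge at `v`; by maximality it also descends, with smaller slope. Rotating a supporting
hyperplane of `[v, w]` then yields a 2-face `F` through `[v, w]` whose top vertex is `v` and whose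
other edge at `v` has smaller slope (`exists_two_face_descending`). Adding the boundary of `F`
cancels `[v, w]` and introduces only smaller edges, so induction applies.

The geometry rests on `IsPolytope.exists_rotation`, on the cone description of a polygon at a vertex
(`HasDim.exists_other_edge`), and on the boundary of a 2-face being a single cycle
(`isFacialCycle_facialGraph`). -/

namespace Polytope

/-! ### Faces, supporting functionals and rotation of hyperplanes. -/

section Faces

variable {E : Type*} [AddCommGroup E] [Module ℝ E] {P F G : Set E} {v w : E}

/-- A level set at which a linear functional attains its maximum is a face. -/
lemma isFace_setOf_eq {k : E →ₗ[ℝ] ℝ} (hk : ∀ x ∈ P, k x ≤ k v) :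
    IsFace P {x | x ∈ P ∧ k x = k v} := by
  by_cases h0 : k = 0
  · left; ext x; simp [h0]
  · exact Or.inr ⟨k, k v, h0, hk, rfl⟩

/-- A face is exposed at each of its points by a linear functional. -/
lemma IsFace.exists_functional (h : IsFace P F) (hv : v ∈ F) :
    ∃ k : E →ₗ[ℝ] ℝ, (∀ x ∈ P, k x ≤ k v) ∧ F = {x | x ∈ P ∧ k x = k v} := by
  rcases h with rfl | ⟨k, a, -, hk, rfl⟩
  · exact ⟨0, by simp, by simp⟩
  · have hva : k v = a := hv.2
    exact ⟨k, by simpa [hva] using hk, by rw [hva]; rfl⟩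

lemma IsFace.subset (h : IsFace P F) : F ⊆ P := by
  rcases h with rfl | ⟨k, a, -, hk, rfl⟩
  · exact subset_rfl
  · exact Set.inter_subset_left

/-- A face of `P` contained in a subset `F` of `P` is a face of `F`. -/
lemma IsFace.of_subset (h : IsFace P G) (hGF : G ⊆ F) (hFP : F ⊆ P) : IsFace F G := by
  rcases h with rfl | ⟨k, a, hk0, hk, rfl⟩
  · exact Or.inl (hGF.antisymm hFP)
  · refine Or.inr ⟨k, a, hk0, fun x hx => hk x (hFP hx), ?_⟩
    ext x
    exact ⟨fun hx => ⟨hGF hx, hx.2⟩, fun hx => ⟨hFP hx.1, hx.2⟩⟩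

/-- A linear inequality on generators holds on the convex hull. -/
lemma le_of_mem_convexHull {X : Set E} (f : E →ₗ[ℝ] ℝ) {a : ℝ} (h : ∀ x ∈ X, f x ≤ a) :
    ∀ x ∈ convexHull ℝ X, f x ≤ a :=
  fun _ hx => convexHull_min (t := {x | f x ≤ a}) h (convex_halfSpace_le f.isLinear a) hx

/-- The set `{k < a}` together with the hull of the generators at level `a` is convex, since mixing
in a point strictly below `a` stays strictly below. It contains `X`, hence its hull. -/
lemma setOf_eq_convexHull {X : Set E} (k : E →ₗ[ℝ] ℝ) {a : ℝ}
    (hk : ∀ x ∈ X, k x ≤ a) :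
    {x | x ∈ convexHull ℝ X ∧ k x = a} = convexHull ℝ {x | x ∈ X ∧ k x = a} := by
  apply Set.Subset.antisymm
  · have hconv : Convex ℝ ({x | k x < a} ∪ convexHull ℝ {x | x ∈ X ∧ k x = a}) := by
      have heq : ∀ x ∈ convexHull ℝ {x | x ∈ X ∧ k x = a}, k x = a := fun x hx =>
        convexHull_min (t := {x | k x = a}) (fun x hx => hx.2)
          (convex_hyperplane k.isLinear a) hx
      have hle : ∀ x ∈ {x | k x < a} ∪ convexHull ℝ {x | x ∈ X ∧ k x = a}, k x ≤ a := by
        rintro x (hx | hx)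
        · exact le_of_lt hx
        · exact (heq x hx).le
      intro x hx y hy s t hs ht hst
      rcases hs.eq_or_lt with rfl | hs'
      · simpa [show t = 1 by linarith] using hy
      rcases ht.eq_or_lt with rfl | ht'
      · simpa [show s = 1 by linarith] using hx
      have hx' := hle x hx
      have hy' := hle y hy
      have key : ∀ {p q : ℝ}, p < a → q ≤ a → ∀ {s t : ℝ}, 0 < s → 0 < t → s + t = 1 →
          s * p + t * q < a := by
        intro p q hp hq s t hs ht hst
        have : a = s * a + t * a := by rw [← add_mul, hst, one_mul]
        nlinarith [mul_lt_mul_of_pos_left hp hs, mul_le_mul_of_nonneg_left hq ht.le]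
      rcases hx with hx | hx
      · left
        simpa using key hx hy' hs' ht' hst
      · rcases hy with hy | hy
        · left
          have := key hy hx' ht' hs' (by linarith)
          simp only [Set.mem_ofPred_eq, map_add, map_smul, smul_eq_mul]
          linarith
        · right
          exact convex_convexHull ℝ _ hx hy hs ht hst
    rintro x ⟨hx, hxa⟩
    have hsub : X ⊆ {x | k x < a} ∪ convexHull ℝ {x | x ∈ X ∧ k x = a} := by
      intro y hy
      rcases (hk y hy).lt_or_eq with h | h
      · exact Or.inl h
      · exact Or.inr (subset_convexHull ℝ _ ⟨hy, h⟩)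
    rcases convexHull_min hsub hconv hx with h | h
    · exact absurd hxa (ne_of_lt h)
    · exact h
  · exact convexHull_min (fun x hx => ⟨subset_convexHull ℝ _ hx.1, hx.2⟩)
      ((convex_convexHull ℝ X).inter (convex_hyperplane k.isLinear a))

/-- A face of a polytope is spanned by the generators it contains. -/
lemma IsFace.eq_convexHull {X : Set E} (h : IsFace (convexHull ℝ X) F) :
    F = convexHull ℝ (X ∩ F) := by
  rcases h with rfl | ⟨k, a, -, hk, rfl⟩
  · rw [Set.inter_eq_left.2 (subset_convexHull ℝ X)]
  · have := setOf_eq_convexHull k (X := X) (a := a)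
      fun x hx => hk x (subset_convexHull ℝ X hx)
    calc convexHull ℝ X ∩ {x | k x = a} = _ := this
      _ = _ := by
        congr 1
        ext x
        exact ⟨fun hx => ⟨hx.1, subset_convexHull ℝ X hx.1, hx.2⟩, fun hx => ⟨hx.1, hx.2.2⟩⟩

lemma IsPolytope.of_isFace (hP : IsPolytope P) (h : IsFace P F) : IsPolytope F := by
  obtain ⟨X, hX, rfl⟩ := hP
  exact ⟨X ∩ F, hX.inter_of_left F, h.eq_convexHull⟩

lemma vertices_convexHull_subset {X : Set E} : vertices (convexHull ℝ X) ⊆ X := by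
  intro v hv
  have h : {v} = convexHull ℝ (X ∩ {v}) := IsFace.eq_convexHull hv
  by_contra hvX
  have : X ∩ {v} = ∅ := by
    ext x; constructor
    · rintro ⟨hx, rfl⟩; exact hvX hx
    · simp
  rw [this, convexHull_empty] at h
  exact Set.singleton_ne_empty v h

lemma IsPolytope.finite_vertices (hP : IsPolytope P) : (vertices P).Finite := by
  obtain ⟨X, hX, rfl⟩ := hP
  exact hX.subset vertices_convexHull_subset

/-- The face relation between polytopes is transitive. -/
lemma IsFace.trans (hP : IsPolytope P) (hF : IsFace P F) (hG : IsFace F G) (hne : G.Nonempty) :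
    IsFace P G := by
  obtain ⟨X, hX, rfl⟩ := hP
  obtain ⟨w, hw⟩ := hne
  obtain ⟨k, hk, hFk⟩ := hF.exists_functional (hG.subset hw)
  obtain ⟨m, hm, rfl⟩ := hG.exists_functional hw
  -- A large multiple of `k` dominates `m` off `F`; finitely many generators make the bound uniform.
  have hN : ∀ᶠ N : ℝ in Filter.atTop, ∀ x ∈ X, m x - m w ≤ N * (k w - k x) := by
    rw [Filter.eventually_all_finite hX]
    intro x hx
    have hxP := subset_convexHull ℝ X hx
    rcases (hk x hxP).lt_or_eq with h | h
    · filter_upwards [Filter.eventually_ge_atTop ((m x - m w) / (k w - k x))] with N hN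
      rwa [div_le_iff₀ (by linarith)] at hN
    · have := hm x (by rw [hFk]; exact ⟨hxP, h⟩)
      filter_upwards with N
      rw [h]; linarith
  obtain ⟨N, hN⟩ := hN.exists
  have hN' : ∀ x ∈ convexHull ℝ X, m x - m w ≤ N * (k w - k x) := by
    have := le_of_mem_convexHull (m + N • k) (a := m w + N * k w) (X := X) (by
      intro x hx
      have := hN x hx
      simp only [LinearMap.add_apply, LinearMap.smul_apply, smul_eq_mul]
      linarith)
    intro x hx
    have := this x hx
    simp only [LinearMap.add_apply, LinearMap.smul_apply, smul_eq_mul] at this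
    linarith
  -- The extra `1` makes equality force `k x = k w`, that is, `x ∈ F`.
  have hface := isFace_setOf_eq (P := convexHull ℝ X) (v := w) (k := m + (N + 1) • k) (by
    intro x hx
    have := hN' x hx
    have := hk x hx
    simp only [LinearMap.add_apply, LinearMap.smul_apply, smul_eq_mul]
    linarith)
  convert hface using 1
  ext x
  simp only [LinearMap.add_apply, LinearMap.smul_apply, smul_eq_mul, Set.mem_ofPred_eq, hFk]
  constructor
  · rintro ⟨⟨hx, h1⟩, h2⟩
    exact ⟨hx, by rw [h1, h2]⟩
  · rintro ⟨hx, h⟩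
    have h1 := hN' x hx
    have h2 := hk x hx
    have h3 : k x = k w := by linarith
    rw [h3] at h
    exact ⟨⟨hx, h3⟩, by linarith⟩

/-- Rotating a supporting hyperplane of a proper face `{k = k v}` in the direction of a functional
`g` that is constant on this face, until it touches further points of the polytope. -/
lemma IsPolytope.exists_rotation (hP : IsPolytope P) {k g : E →ₗ[ℝ] ℝ} (hk : ∀ x ∈ P, k x ≤ k v)
    (hg : ∀ x ∈ P, k x = k v → g x = g v) (hne : ∃ x ∈ P, k x ≠ k v) :
    ∃ t : ℝ, (∀ x ∈ P, t * (k v - k x) ≤ g x - g v) ∧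
      IsFace P {x | x ∈ P ∧ g x - g v = t * (k v - k x)} ∧
      ∃ y ∈ P, k y ≠ k v ∧ g y - g v = t * (k v - k y) := by
  obtain ⟨X, hX, rfl⟩ := hP
  have hXne : (hX.toFinset.filter fun x => k x ≠ k v).Nonempty := by
    by_contra h
    obtain ⟨x, hx, hxv⟩ := hne
    apply hxv
    refine convexHull_min (t := {x | k x = k v}) (fun y hy => ?_)
      (convex_hyperplane k.isLinear (k v)) hx
    by_contra hyv
    exact h ⟨y, by simpa using ⟨hy, hyv⟩⟩
  -- The minimal ratio over generators off the face is the extreme `t` for which `-g - t • k` is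
  -- still maximal at `v`; a minimiser is a new contact point.
  obtain ⟨y, hy, hmin⟩ := Finset.exists_min_image _ (fun x => (g x - g v) / (k v - k x)) hXne
  simp only [Finset.mem_filter, Set.Finite.mem_toFinset, and_imp] at hy hmin
  have hyP := subset_convexHull ℝ X hy.1
  have hylt := lt_of_le_of_ne (hk y hyP) hy.2
  set t := (g y - g v) / (k v - k y) with ht
  have hty : g y - g v = t * (k v - k y) := by
    rw [ht, div_mul_cancel₀]; exact sub_ne_zero.2 hylt.ne'
  have hle : ∀ x ∈ convexHull ℝ X, t * (k v - k x) ≤ g x - g v := by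
    have := le_of_mem_convexHull (-g - t • k) (a := - g v - t * k v) (X := X) (by
      intro x hx
      have hxP := subset_convexHull ℝ X hx
      simp only [LinearMap.sub_apply, LinearMap.neg_apply, LinearMap.smul_apply, smul_eq_mul]
      by_cases hxv : k x = k v
      · rw [hxv, hg x hxP hxv]
      · have h1 := hmin x hx hxv
        have h2 := lt_of_le_of_ne (hk x hxP) hxv
        rw [le_div_iff₀ (by linarith)] at h1
        linarith)
    intro x hx
    have := this x hx
    simp only [LinearMap.sub_apply, LinearMap.neg_apply, LinearMap.smul_apply, smul_eq_mul] at this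
    linarith
  refine ⟨t, hle, ?_, y, hyP, hy.2, hty⟩
  have hface := isFace_setOf_eq (P := convexHull ℝ X) (v := v) (k := -g - t • k) (by
    intro x hx
    have := hle x hx
    simp only [LinearMap.sub_apply, LinearMap.neg_apply, LinearMap.smul_apply, smul_eq_mul]
    linarith)
  convert hface using 1
  ext x
  simp only [LinearMap.sub_apply, LinearMap.neg_apply, LinearMap.smul_apply, smul_eq_mul,
    Set.mem_ofPred_eq]
  exact and_congr_right fun _ => ⟨fun h => by linarith, fun h => by linarith⟩

end Faces

/-! ### Dimensions of faces. -/

section Dimension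

variable {E : Type*} [AddCommGroup E] [Module ℝ E] {P F G : Set E} {v w : E}

lemma vectorSpan_le_ker {k : E →ₗ[ℝ] ℝ} {a : ℝ} (h : ∀ x ∈ F, k x = a) :
    vectorSpan ℝ F ≤ LinearMap.ker k := by
  rw [vectorSpan_def, Submodule.span_le]
  rintro _ ⟨x, hx, y, hy, rfl⟩
  simp [h x hx, h y hy]

lemma sub_mem_vectorSpan (hv : v ∈ F) (hw : w ∈ F) : w - v ∈ vectorSpan ℝ F :=
  vsub_mem_vectorSpan ℝ hw hv

variable [FiniteDimensional ℝ E]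

/-- A proper nonempty face has smaller dimension. -/
lemma IsFace.finrank_lt (h : IsFace P F) (hne : F.Nonempty) (hFP : F ≠ P) :
    Module.finrank ℝ (vectorSpan ℝ F) < Module.finrank ℝ (vectorSpan ℝ P) := by
  obtain ⟨v, hv⟩ := hne
  obtain ⟨k, hk, hF⟩ := h.exists_functional hv
  have hvP := h.subset hv
  apply Submodule.finrank_lt_finrank_of_lt
  refine lt_of_le_of_ne (vectorSpan_mono ℝ h.subset) fun heq => hFP ?_
  have hker : vectorSpan ℝ F ≤ LinearMap.ker k :=
    vectorSpan_le_ker (a := k v) fun x hx => by rw [hF] at hx; exact hx.2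
  refine h.subset.antisymm fun x hx => ?_
  have := hker (heq ▸ sub_mem_vectorSpan hvP hx)
  rw [LinearMap.mem_ker, map_sub, sub_eq_zero] at this
  rw [hF]; exact ⟨hx, this⟩

lemma finrank_vectorSpan_pos (hv : v ∈ F) (hw : w ∈ F) (hvw : v ≠ w) :
    0 < Module.finrank ℝ (vectorSpan ℝ F) := by
  rw [Module.finrank_pos_iff_exists_ne_zero]
  exact ⟨⟨w - v, sub_mem_vectorSpan hv hw⟩, by simpa [sub_eq_zero] using hvw.symm⟩

/-- Every proper nonempty face of a polytope is a facet of a face. -/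
lemma IsPolytope.exists_isFace_finrank_succ (hP : IsPolytope P) (hG : IsFace P G)
    (hne : G.Nonempty) (hGP : G ≠ P) :
    ∃ F, IsFace P F ∧ G ⊆ F ∧
      Module.finrank ℝ (vectorSpan ℝ F) = Module.finrank ℝ (vectorSpan ℝ G) + 1 := by
  obtain ⟨F, ⟨hF, hGF, hFne⟩, hmin⟩ := WellFounded.has_min
    (InvImage.wf (fun F : Set E => Module.finrank ℝ (vectorSpan ℝ F)) wellFounded_lt)
    {F | IsFace P F ∧ G ⊆ F ∧ G ≠ F} ⟨P, Or.inl rfl, hG.subset, hGP⟩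
  refine ⟨F, hF, hGF, ?_⟩
  have hGF' : IsFace F G := hG.of_subset hGF hF.subset
  obtain ⟨v, hv⟩ := hne
  have hlt := hGF'.finrank_lt ⟨v, hv⟩ hFne
  by_contra hdim
  obtain ⟨k, hk, hGk⟩ := hGF'.exists_functional hv
  obtain ⟨x, hxF, hxG⟩ : ∃ x ∈ F, x ∉ G := by
    by_contra! h
    exact hFne (hGF.antisymm h)
  have hkx : k x ≠ k v := fun h => hxG (by rw [hGk]; exact ⟨hxF, h⟩)
  -- A dimension gap of at least 2 leaves room for a functional `g` constant on `G ∪ {x}` but not on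
  -- `F`. Rotating towards `g` gives a face strictly between `G` and `F`, against minimality.
  obtain ⟨y, hy, hyn⟩ : ∃ y ∈ vectorSpan ℝ F, y ∉ vectorSpan ℝ G ⊔ ℝ ∙ (x - v) := by
    by_contra! h
    have h1 := Submodule.finrank_mono (show vectorSpan ℝ F ≤ vectorSpan ℝ G ⊔ ℝ ∙ (x - v) from h)
    have h2 := Submodule.finrank_add_le_finrank_add_finrank (vectorSpan ℝ G) (ℝ ∙ (x - v))
    have h3 : Module.finrank ℝ (ℝ ∙ (x - v)) ≤ 1 := by
      simpa using finrank_span_le_card (R := ℝ) ({x - v} : Set E)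
    omega
  obtain ⟨g, hgy, hg⟩ := Submodule.exists_le_ker_of_notMem hyn
  have hgx : g x = g v := by
    have := hg (Submodule.mem_sup_right (Submodule.mem_span_singleton_self (x - v)))
    rwa [LinearMap.mem_ker, map_sub, sub_eq_zero] at this
  have hgG : ∀ z ∈ F, k z = k v → g z = g v := by
    intro z hz hzv
    have : z ∈ G := by rw [hGk]; exact ⟨hz, hzv⟩
    have := hg (Submodule.mem_sup_left (sub_mem_vectorSpan hv this))
    rwa [LinearMap.mem_ker, map_sub, sub_eq_zero] at this
  obtain ⟨t, -, hface, z, hz, hzv, hzt⟩ :=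
    (hP.of_isFace hF).exists_rotation hk hgG ⟨x, hxF, hkx⟩
  have hvF := hGF hv
  have hvF' : v ∈ {x | x ∈ F ∧ g x - g v = t * (k v - k x)} := ⟨hvF, by simp⟩
  have hF'ne : {x | x ∈ F ∧ g x - g v = t * (k v - k x)} ≠ F := by
    intro heq
    have hxF' := hxF
    rw [← heq] at hxF'
    have ht : t = 0 := by
      have := hxF'.2
      rw [hgx, sub_self, eq_comm, mul_eq_zero] at this
      exact this.resolve_right (sub_ne_zero.2 hkx.symm)
    have : vectorSpan ℝ F ≤ LinearMap.ker g := vectorSpan_le_ker (a := g v) fun x hx => by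
      rw [← heq, ht] at hx
      have := hx.2
      linarith
    exact hgy (this hy)
  refine hmin _ ⟨hF.trans hP hface ⟨v, hvF'⟩, ?_, ?_⟩ (hface.finrank_lt ⟨v, hvF'⟩ hF'ne)
  · intro u hu
    have huF := hGF hu
    rw [hGk] at hu
    exact ⟨huF, by rw [hgG u hu.1 hu.2, hu.2]; ring⟩
  · intro heq
    have : z ∈ G := by rw [heq]; exact ⟨hz, hzt⟩
    rw [hGk] at this
    exact hzv this.2

end Dimension

/-! ### Vertices and edges. -/

section Edges

variable {E : Type*} [AddCommGroup E] [Module ℝ E] {P F G e : Set E} {v w x z : E}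

lemma mem_of_mem_vertices (hv : v ∈ vertices P) : v ∈ P :=
  IsFace.subset hv rfl

lemma exists_functional_of_mem_vertices (hv : v ∈ vertices P) :
    ∃ h : E →ₗ[ℝ] ℝ, ∀ x ∈ P, x ≠ v → h x < h v := by
  obtain ⟨h, hh, heq⟩ := IsFace.exists_functional hv rfl
  refine ⟨h, fun x hx hxv => lt_of_le_of_ne (hh x hx) fun hxeq => hxv ?_⟩
  have : x ∈ ({v} : Set E) := by rw [heq]; exact ⟨hx, hxeq⟩
  exact this

lemma mem_vertices_of_subset (hv : v ∈ vertices P) (hvF : v ∈ F) (hFP : F ⊆ P) :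
    v ∈ vertices F :=
  IsFace.of_subset hv (by simpa using hvF) hFP

lemma mem_vertices_of_isFace (hP : IsPolytope P) (hF : IsFace P F) (hv : v ∈ vertices F) :
    v ∈ vertices P :=
  hF.trans hP hv ⟨v, rfl⟩

lemma JoinedByEdge.of_isFace (hP : IsPolytope P) (hF : IsFace P F) (h : JoinedByEdge F v w) :
    JoinedByEdge P v w := by
  obtain ⟨hne, hv, hw, e, he, hd, hve, hwe⟩ := h
  exact ⟨hne, mem_vertices_of_isFace hP hF hv, mem_vertices_of_isFace hP hF hw, e,
    hF.trans hP he ⟨v, hve⟩, hd, hve, hwe⟩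

lemma JoinedByEdge.symm (h : JoinedByEdge P v w) : JoinedByEdge P w v := by
  obtain ⟨hne, hv, hw, e, he, hd, hve, hwe⟩ := h
  exact ⟨hne.symm, hw, hv, e, he, hd, hwe, hve⟩

/-- A vertex is not in the relative interior of a segment. -/
lemma eq_of_mem_vertices_of_between {c : ℝ} {y : E} (hz : z ∈ vertices P) (hx : x ∈ P) (hy : y ∈ P)
    (h0 : 0 < c) (h1 : c < 1) (h : z - x = c • (y - x)) : z = x := by
  obtain ⟨q, hq⟩ := exists_functional_of_mem_vertices hz
  by_contra hne
  have hx' := hq x hx (Ne.symm hne)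
  have hy' : q y ≤ q z := by
    by_cases hyz : y = z
    · rw [hyz]
    · exact (hq y hy hyz).le
  have := congrArg q h
  simp only [map_sub, map_smul, smul_eq_mul] at this
  nlinarith

lemma HasDim.exists_smul_eq (hd : HasDim e 1) (hv : v ∈ e) (hw : w ∈ e) (hvw : w ≠ v)
    (hx : x ∈ e) : ∃ c : ℝ, x - v = c • (w - v) := by
  have hne : (⟨w - v, sub_mem_vectorSpan hv hw⟩ : vectorSpan ℝ e) ≠ 0 := by
    simpa [sub_eq_zero] using hvw
  obtain ⟨c, hc⟩ := (finrank_eq_one_iff_of_nonzero' _ hne).1 hd.2 ⟨x - v, sub_mem_vectorSpan hv hx⟩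
  exact ⟨c, (congrArg Subtype.val hc).symm⟩

/-- A one-dimensional face contains at most two vertices. -/
lemma HasDim.eq_or_eq_of_mem_vertices (hd : HasDim e 1) (hv : v ∈ vertices e) (hw : w ∈ vertices e)
    (hvw : w ≠ v) (hz : z ∈ vertices e) : z = v ∨ z = w := by
  have hve := mem_of_mem_vertices hv
  have hwe := mem_of_mem_vertices hw
  have hze := mem_of_mem_vertices hz
  obtain ⟨c, hc⟩ := hd.exists_smul_eq hve hwe hvw hze
  -- On the line with `v` at 0 and `w` at 1, the vertex `z` sits at `c`. Unless `c` is 0 or 1, one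
  -- of the three vertices lies strictly between the others.
  rcases lt_trichotomy c 0 with h | h | h
  · exfalso
    refine hvw.symm (eq_of_mem_vertices_of_between hv hwe hze (c := (1 - c)⁻¹)
      (inv_pos.2 (by linarith)) (inv_lt_one_of_one_lt₀ (by linarith)) ?_)
    have : z - w = (1 - c) • (v - w) := by
      rw [← sub_sub_sub_cancel_right z w v, hc]; module
    rw [this, smul_smul, inv_mul_cancel₀ (by linarith), one_smul]
  · left
    rwa [h, zero_smul, sub_eq_zero] at hc
  · rcases lt_trichotomy c 1 with h' | h' | h'
    · exact Or.inl (eq_of_mem_vertices_of_between hz hve hwe h h' hc)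
    · right
      rwa [h', one_smul, sub_left_inj] at hc
    · exfalso
      refine hvw (eq_of_mem_vertices_of_between hw hve hze (c := c⁻¹)
        (inv_pos.2 h) (inv_lt_one_of_one_lt₀ h') ?_)
      rw [hc, smul_smul, inv_mul_cancel₀ h.ne', one_smul]

/-- A one-dimensional polytope has a second vertex besides a given one. -/
lemma HasDim.exists_ne_mem_vertices (he : IsPolytope e) (hd : HasDim e 1) (hv : v ∈ vertices e) :
    ∃ w ∈ vertices e, w ≠ v := by
  obtain ⟨h, hh⟩ := exists_functional_of_mem_vertices hv
  have hve := mem_of_mem_vertices hv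
  obtain ⟨y, hy, hyv⟩ : ∃ y ∈ e, y ≠ v := by
    by_contra! hall
    have hsub : e.Subsingleton := fun a ha b hb => (hall a ha).trans (hall b hb).symm
    have := hd.2
    rw [vectorSpan_eq_bot_iff_subsingleton ℝ |>.2 hsub] at this
    simp at this
  obtain ⟨X, hX, rfl⟩ := he
  obtain ⟨w, hwX, hmin⟩ := Set.exists_min_image X h hX ⟨v, vertices_convexHull_subset hv⟩
  have hle : ∀ x ∈ convexHull ℝ X, (-h) x ≤ (-h) w :=
    le_of_mem_convexHull (-h) fun x hx => neg_le_neg (hmin x hx)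
  have hw := subset_convexHull ℝ X hwX
  have hwv : w ≠ v := by
    rintro rfl
    have h1 := hle y hy
    have h2 := hh y hy hyv
    simp only [LinearMap.neg_apply] at h1
    linarith
  refine ⟨w, ?_, hwv⟩
  have hface := isFace_setOf_eq hle
  -- Since `h w < h v`, `h` is injective on the line spanned by `e`, so its minimum is attained only
  -- once.
  have heq : {x | x ∈ convexHull ℝ X ∧ (-h) x = (-h) w} = {w} := by
    ext x
    simp only [LinearMap.neg_apply, neg_inj, Set.mem_ofPred_eq, Set.mem_singleton_iff]
    refine ⟨fun ⟨hx, hxw⟩ => ?_, fun hx => by rw [hx]; exact ⟨hw, rfl⟩⟩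
    obtain ⟨c, hc⟩ := hd.exists_smul_eq hve hw hwv hx
    have h1 := congrArg h hc
    have h2 := hh w hw hwv
    simp only [map_sub, map_smul, smul_eq_mul, hxw] at h1
    have h3 : c = 1 := by
      have : (c - 1) * (h w - h v) = 0 := by linarith
      rcases mul_eq_zero.1 this with h4 | h4 <;> linarith
    rwa [h3, one_smul, sub_left_inj] at hc
  rw [heq] at hface
  exact hface

lemma exists_joinedByEdge_of_isFace (hP : IsPolytope P) (he : IsFace P e) (hd : HasDim e 1)
    (hv : v ∈ vertices P) (hve : v ∈ e) : ∃ w ∈ e, JoinedByEdge P v w := by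
  obtain ⟨w, hw, hwv⟩ := hd.exists_ne_mem_vertices (hP.of_isFace he)
    (mem_vertices_of_subset hv hve he.subset)
  have hwe := mem_of_mem_vertices hw
  exact ⟨w, hwe, hwv.symm, hv, mem_vertices_of_isFace hP he hw, e, he, hd, hve, hwe⟩

lemma HasDim.eq_or_eq_of_isFace (he : IsFace P e) (hd : HasDim e 1) (hv : v ∈ vertices P)
    (hve : v ∈ e) (hw : w ∈ vertices P) (hwe : w ∈ e) (hvw : w ≠ v) (hz : z ∈ vertices P)
    (hze : z ∈ e) : z = v ∨ z = w :=
  hd.eq_or_eq_of_mem_vertices (mem_vertices_of_subset hv hve he.subset)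
    (mem_vertices_of_subset hw hwe he.subset) hvw (mem_vertices_of_subset hz hze he.subset)

end Edges

/-! ### Polygons at a vertex, and 2-faces through an edge. -/

section Polygons

variable {E : Type*} [AddCommGroup E] [Module ℝ E] [FiniteDimensional ℝ E] {P F e : Set E}
  {v w : E}

/-- A vertex of a polytope of positive dimension lies on an edge. -/
lemma exists_joinedByEdge (hP : IsPolytope P) (hv : v ∈ vertices P) (hne : P ≠ {v}) :
    ∃ w, JoinedByEdge P v w := by
  obtain ⟨e, he, hve, hd⟩ := hP.exists_isFace_finrank_succ hv ⟨v, rfl⟩ hne.symm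
  have hve : v ∈ e := hve rfl
  have hd : HasDim e 1 := ⟨⟨v, hve⟩, by rw [hd, vectorSpan_singleton, finrank_bot]⟩
  obtain ⟨w, -, hw⟩ := exists_joinedByEdge_of_isFace hP he hd hv hve
  exact ⟨w, hw⟩

/-- At a vertex `v` of a polygon, besides an edge `[v, w]` there is exactly one further edge
`[v, w']`, and the polygon lies in the cone spanned by the two edges. -/
lemma HasDim.exists_other_edge (hF : IsPolytope F) (hd : HasDim F 2) (hv : v ∈ vertices F)
    (he : IsFace F e) (hde : HasDim e 1) (hve : v ∈ e) (hw : w ∈ vertices F) (hwe : w ∈ e)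
    (hwv : w ≠ v) :
    ∃ w', w' ∉ e ∧ JoinedByEdge F v w' ∧ (∀ z, JoinedByEdge F v z → z = w ∨ z = w') ∧
      ∀ x ∈ F, ∃ a b : ℝ, 0 ≤ a ∧ 0 ≤ b ∧ x - v = a • (w - v) + b • (w' - v) := by
  obtain ⟨h, hh⟩ := exists_functional_of_mem_vertices hv
  have hvF := mem_of_mem_vertices hv
  have hwF := mem_of_mem_vertices hw
  have hh' : ∀ x ∈ F, h x ≤ h v := fun x hx => by
    by_cases hxv : x = v
    · rw [hxv]
    · exact (hh x hx hxv).le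
  have hheq : ∀ x ∈ F, h x = h v → x = v := fun x hx hxv => by
    by_contra hne
    exact (hh x hx hne).ne hxv
  obtain ⟨k, hk, rfl⟩ := he.exists_functional hve
  have hkw : k w = k v := hwe.2
  have hhw := hh w hwF hwv
  obtain ⟨x₀, hx₀, hkx₀⟩ : ∃ x ∈ F, k x ≠ k v := by
    by_contra! hall
    have : {x | x ∈ F ∧ k x = k v} = F := by
      ext x; exact ⟨fun hx => hx.1, fun hx => ⟨hx, hall x hx⟩⟩
    rw [this] at hde
    have := hde.2.symm.trans hd.2
    omega
  have hx₀v : x₀ ≠ v := by rintro rfl; exact hkx₀ rfl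
  -- The hyperplane of `h` meets `F` in `v` alone; it is rotated until it touches the side of `F`
  -- other than `e`.
  obtain ⟨t, hle, hface, y, hy, hyv, hyt⟩ := hF.exists_rotation (g := k) hh'
    (fun x hx hxv => by rw [hheq x hx hxv]) ⟨x₀, hx₀, (hh x₀ hx₀ hx₀v).ne⟩
  have ht : t < 0 := by
    have h1 := hle x₀ hx₀
    have h2 := lt_of_le_of_ne (hk x₀ hx₀) hkx₀
    have h3 := hh x₀ hx₀ hx₀v
    by_contra hcon
    have := mul_nonneg (not_lt.1 hcon) (sub_nonneg.2 h3.le)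
    linarith
  set e' := {x | x ∈ F ∧ k x - k v = t * (h v - h x)} with he'
  have hve' : v ∈ e' := ⟨hvF, by simp⟩
  have hye' : y ∈ e' := ⟨hy, hyt⟩
  have hyv' : y ≠ v := by rintro rfl; exact hyv rfl
  have hwe' : w ∉ e' := fun hw' => by
    have := hw'.2
    rw [hkw, sub_self, eq_comm, mul_eq_zero] at this
    rcases this with h1 | h1 <;> linarith
  have hde' : HasDim e' 1 := by
    refine ⟨⟨v, hve'⟩, ?_⟩
    have h1 := hface.finrank_lt ⟨v, hve'⟩ fun heq => hwe' (heq ▸ hwF)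
    have h2 := finrank_vectorSpan_pos hve' hye' hyv'.symm
    have := hd.2
    omega
  obtain ⟨w', hw'e', hvw'⟩ := exists_joinedByEdge_of_isFace hF hface hde' hv hve'
  have hw'v : w' ≠ v := hvw'.1.symm
  have hw'F := mem_of_mem_vertices hvw'.2.2.1
  have hhw' := hh w' hw'F hw'v
  have hkw' : k w' - k v = t * (h v - h w') := hw'e'.2
  have hkw'lt : k w' - k v < 0 := by
    rw [hkw']; exact mul_neg_of_neg_of_pos ht (by linarith)
  have hspan : Submodule.span ℝ {w - v, w' - v} = vectorSpan ℝ F := by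
    apply Submodule.eq_of_le_of_finrank_eq
    · rw [Submodule.span_le]
      rintro _ (rfl | rfl)
      · exact sub_mem_vectorSpan hvF hwF
      · exact sub_mem_vectorSpan hvF hw'F
    · have hli : LinearIndependent ℝ ![w - v, w' - v] := by
        rw [LinearIndependent.pair_iff]
        intro a b hab
        have h1 := congrArg k hab
        have h2 := congrArg h hab
        simp only [map_add, map_smul, map_sub, smul_eq_mul, map_zero, hkw, sub_self, mul_zero,
          zero_add] at h1 h2
        have hb : b = 0 := (mul_eq_zero.1 h1).resolve_right hkw'lt.ne
        rw [hb, zero_mul, add_zero] at h2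
        exact ⟨(mul_eq_zero.1 h2).resolve_right (by linarith), hb⟩
      have := finrank_span_eq_card hli
      rw [hd.2]
      rwa [Matrix.range_cons, Matrix.range_cons, Matrix.range_empty, Set.union_empty,
        Set.singleton_union, Fintype.card_fin] at this
  -- Each of the two supporting inequalities is tight along one edge, so it fixes the sign of the
  -- coefficient of the other.
  have hcone : ∀ x ∈ F, ∃ a b : ℝ, 0 ≤ a ∧ 0 ≤ b ∧ x - v = a • (w - v) + b • (w' - v) := by
    intro x hx
    have hmem := sub_mem_vectorSpan hvF hx
    rw [← hspan, Submodule.mem_span_pair] at hmem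
    obtain ⟨a, b, hab⟩ := hmem
    have h1 := congrArg k hab
    have h2 := congrArg h hab
    simp only [map_add, map_smul, map_sub, smul_eq_mul, hkw, sub_self, mul_zero, zero_add] at h1 h2
    have h3 := hk x hx
    have h4 := hle x hx
    refine ⟨a, b, ?_, ?_, hab.symm⟩
    · by_contra hcon
      have h5 : h v - h x = a * (h v - h w) + b * (h v - h w') := by linarith
      rw [h5, ← h1, hkw', mul_add] at h4
      have h6 : 0 < t * (a * (h v - h w)) :=
        mul_pos_of_neg_of_neg ht (mul_neg_of_neg_of_pos (not_le.1 hcon) (by linarith))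
      linarith
    · by_contra hcon
      have := mul_pos_of_neg_of_neg (not_le.1 hcon) hkw'lt
      linarith
  refine ⟨w', fun hw'e => by linarith [hw'e.2], hvw', ?_, hcone⟩
  rintro z ⟨hvz, -, hz, e'', he'', hde'', hve'', hze''⟩
  have hzF := mem_of_mem_vertices hz
  obtain ⟨a, b, ha, hb, hab⟩ := hcone z hzF
  obtain ⟨q, hq, rfl⟩ := he''.exists_functional hve''
  have hk1 := congrArg k hab
  have hh1 := congrArg h hab
  have hq1 := congrArg q hab
  simp only [map_add, map_smul, map_sub, smul_eq_mul, hkw, sub_self, mul_zero, zero_add]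
    at hk1 hh1 hq1
  -- If `a` or `b` is zero, `z` lies on `e'` or `e`. If both are positive, the functional `q`
  -- exposing `[v, z]` is constant on both edges, which puts the three vertices `v`, `w`, `w'` on
  -- one edge.
  rcases ha.eq_or_lt with rfl | ha
  · right
    refine (hde'.eq_or_eq_of_isFace hface hv hve' hvw'.2.2.1 hw'e' hw'v hz ⟨hzF, ?_⟩).resolve_left
      hvz.symm
    have h1 : h v - h z = b * (h v - h w') := by linarith
    rw [hk1, hkw', h1]; ring
  rcases hb.eq_or_lt with rfl | hb
  · left
    refine (hde.eq_or_eq_of_isFace he hv hve hw hwe hwv hz ⟨hzF, by linarith⟩).resolve_left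
      hvz.symm
  have hqz : q z = q v := hze''.2
  have hqw := hq w hwF
  have hqw' := hq w' hw'F
  have h1 := mul_nonneg ha.le (sub_nonneg.2 hqw)
  have h2 := mul_nonneg hb.le (sub_nonneg.2 hqw')
  have h3 : a * (q v - q w) = 0 := by linarith
  have h4 : b * (q v - q w') = 0 := by linarith
  have h5 := (mul_eq_zero.1 h3).resolve_left ha.ne'
  have h6 := (mul_eq_zero.1 h4).resolve_left hb.ne'
  rcases hde''.eq_or_eq_of_isFace he'' hv hve'' hw ⟨hwF, by linarith⟩ hwv hvw'.2.2.1
    ⟨hw'F, by linarith⟩ with h7 | h7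
  · exact absurd h7 hw'v
  · rw [h7] at hkw'lt; linarith

/-- An edge of a polytope lies on a `2`-face on which, at a given end `v`, the other edge has
smaller slope with respect to `g`, provided the polytope has points of smaller `g`-value. -/
lemma exists_two_face_of_lt (hP : IsPolytope P) (he : IsFace P e) (hde : HasDim e 1) (hve : v ∈ e)
    {g : E →ₗ[ℝ] ℝ} (hg : ∀ x ∈ e, g x = g v) {y : E} (hy : y ∈ P) (hyg : g y < g v) :
    ∃ F, IsFace P F ∧ HasDim F 2 ∧ e ⊆ F ∧ ∀ x ∈ F, x ∉ e → g x < g v := by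
  obtain ⟨k, hk, rfl⟩ := he.exists_functional hve
  have hky : k y ≠ k v := fun h => hyg.ne (hg y ⟨hy, h⟩)
  obtain ⟨t, hle, hface, z, hz, hzv, hzt⟩ :=
    hP.exists_rotation hk (fun x hx hxv => hg x ⟨hx, hxv⟩) ⟨y, hy, hky⟩
  -- The sign of `t` says that on `F'` the value of `g` drops strictly off `e`; any 2-face of `F'`
  -- through `e` inherits this.
  have ht : t < 0 := by
    have h1 := hle y hy
    have h2 := hk y hy
    by_contra hcon
    have := mul_nonneg (not_lt.1 hcon) (sub_nonneg.2 h2)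
    linarith
  set e := {x | x ∈ P ∧ k x = k v} with he_def
  set F' := {x | x ∈ P ∧ g x - g v = t * (k v - k x)} with hF'
  have heF' : e ⊆ F' := fun x hx => ⟨hx.1, by rw [hg x hx, hx.2]; ring⟩
  have heF'ne : e ≠ F' := fun heq => by
    have : z ∈ e := by rw [heq]; exact ⟨hz, hzt⟩
    exact hzv this.2
  obtain ⟨F, hF, heF, hdF⟩ := (hP.of_isFace hface).exists_isFace_finrank_succ
    (he.of_subset heF' hface.subset) ⟨v, hve⟩ heF'ne
  refine ⟨F, hface.trans hP hF ⟨v, heF hve⟩, ⟨⟨v, heF hve⟩, by rw [hdF, hde.2]⟩, heF, ?_⟩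
  intro x hx hxe
  have hxF' := hF.subset hx
  have hkx : k x < k v := lt_of_le_of_ne (hk x hxF'.1) fun h => hxe ⟨hxF'.1, h⟩
  have h1 := hxF'.2
  have := mul_neg_of_neg_of_pos ht (sub_pos.2 hkx)
  linarith

end Polygons
-- Even subgraphs and cycles in finite graphs.
section Parity

variable {V : Type*} {G A B C : SimpleGraph V}

lemma even_ncard_symmDiff {S T : Set V} (hS : S.Finite) (hT : T.Finite) (hS' : Even S.ncard)
    (hT' : Even T.ncard) : Even (S ∆ T).ncard := by
  have h1 := Set.ncard_inter_add_ncard_sdiff_eq_ncard S T hS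
  have h2 := Set.ncard_inter_add_ncard_sdiff_eq_ncard T S hT
  have h3 : (S ∆ T).ncard = (S \ T).ncard + (T \ S).ncard :=
    Set.ncard_union_eq disjoint_sdiff_sdiff hS.sdiff hT.sdiff
  rw [Set.inter_comm] at h2
  rw [Nat.even_iff] at *
  omega

lemma symmDiff_adj {v w : V} : (A ∆ B).Adj v w ↔ ¬(A.Adj v w ↔ B.Adj v w) := by
  simp only [symmDiff_def, SimpleGraph.sup_adj, SimpleGraph.sdiff_adj]
  tauto

lemma IsEvenSubgraph.symmDiff [Finite V] (hA : IsEvenSubgraph G A) (hB : IsEvenSubgraph G B) :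
    IsEvenSubgraph G (A ∆ B) := by
  refine ⟨fun v w h => ?_, fun v => ?_⟩
  · by_contra hG
    exact symmDiff_adj.1 h (iff_of_false (fun h => hG (hA.1 h)) fun h => hG (hB.1 h))
  · have : (A ∆ B).neighborSet v = A.neighborSet v ∆ B.neighborSet v := by
      ext w
      simp only [SimpleGraph.mem_neighborSet, symmDiff_adj, Set.mem_symmDiff]
      tauto
    rw [this]
    exact even_ncard_symmDiff (Set.toFinite _) (Set.toFinite _) (hA.2 v) (hB.2 v)

lemma IsCycleOf.isEvenSubgraph (h : IsCycleOf G C) : IsEvenSubgraph G C := by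
  obtain ⟨u, p, hp, rfl⟩ := h
  refine ⟨p.toSubgraph.spanningCoe_le, fun v => ?_⟩
  rcases Set.eq_empty_or_nonempty (p.toSubgraph.spanningCoe.neighborSet v) with h | h
  · simp [h]
  · rw [hp.isCycles_spanningCoe_toSubgraph h]
    exact even_two

/-- A `2`-regular graph on one connected component (and isolated vertices elsewhere) is a cycle. -/
lemma isCycleOf_of_isCycles [Finite V] (hCG : C ≤ G) (hC : C.IsCycles) {u : V}
    (hu : (C.neighborSet u).Nonempty) (hconn : ∀ a b, C.Adj a b → C.Reachable u a) :
    IsCycleOf G C := by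
  obtain ⟨p, hp, hverts⟩ := hC.exists_cycle_toSubgraph_verts_eq_connectedComponentSupp
    (c := C.connectedComponentMk u) (v := u) rfl hu
  refine ⟨u, p.mapLe hCG, hp.mapLe hCG, ?_⟩
  classical
  have := Fintype.ofFinite V
  ext a b
  rw [SimpleGraph.Subgraph.spanningCoe_adj, SimpleGraph.Walk.adj_toSubgraph_iff_mem_edges,
    SimpleGraph.Walk.edges_mapLe_eq_edges, ← SimpleGraph.Walk.adj_toSubgraph_iff_mem_edges]
  refine ⟨fun h => ?_, fun h => h.adj_sub⟩
  have ha : a ∈ p.toSubgraph.verts := by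
    rw [hverts, SimpleGraph.ConnectedComponent.mem_supp_iff, SimpleGraph.ConnectedComponent.eq]
    exact (hconn a b h).symm
  exact (hp.adj_toSubgraph_iff_of_isCycles hC ha b).2 h

end Parity

/-! ### Boundaries of 2-faces are cycles. -/

section FacialCycles

variable {E : Type*} [AddCommGroup E] [Module ℝ E] {P F : Set E}

/-- The graph of `F` as a graph on the vertices of `P`. -/
def facialGraph (P F : Set E) : SimpleGraph (vertices P) where
  Adj v w := JoinedByEdge F v w
  symm := ⟨fun _ _ h => h.symm⟩
  loopless := ⟨fun _ h => h.1 rfl⟩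

/-- Finitely many nonzero vectors, here the differences, all avoid the kernel of some functional. -/
lemma exists_injOn_functional {S : Set E} (hS : S.Finite) :
    ∃ l : E →ₗ[ℝ] ℝ, Set.InjOn l S := by
  have := hS.to_subtype
  obtain ⟨l, hl⟩ := Module.exists_dual_forall_apply_ne_zero (K := ℝ)
    (fun i : {i : S × S // i.1 ≠ i.2} => (i.1.1 - i.1.2 : E))
    (fun i => by simpa [sub_eq_zero, Subtype.val_inj] using i.2)
  refine ⟨l, fun v hv w hw h => ?_⟩
  by_contra hne
  exact hl ⟨(⟨v, hv⟩, ⟨w, hw⟩), by simpa using hne⟩ (by simp [h])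

variable [FiniteDimensional ℝ E]

/-- The two neighbours of a vertex in a polygon. -/
lemma HasDim.exists_neighbors (hF : IsPolytope F) (hd : HasDim F 2) {v : E} (hv : v ∈ vertices F) :
    ∃ w w', w ≠ w' ∧ JoinedByEdge F v w ∧ JoinedByEdge F v w' ∧
      (∀ z, JoinedByEdge F v z → z = w ∨ z = w') ∧
      ∀ x ∈ F, ∃ a b : ℝ, 0 ≤ a ∧ 0 ≤ b ∧ x - v = a • (w - v) + b • (w' - v) := by
  obtain ⟨w, hvw⟩ := exists_joinedByEdge hF hv (by
    rintro rfl
    have := hd.2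
    rw [vectorSpan_singleton, finrank_bot] at this
    omega)
  obtain ⟨hne, -, hw, e, he, hde, hve, hwe⟩ := id hvw
  obtain ⟨w', hw'e, hvw', hz, hcone⟩ := hd.exists_other_edge hF hv he hde hve hw hwe hne.symm
  exact ⟨w, w', fun h => hw'e (h ▸ hwe), hvw, hvw', hz, hcone⟩

/-- The boundary of a `2`-face is a facial cycle. -/
lemma isFacialCycle_facialGraph (hP : IsPolytope P) (hF : IsFace P F) (hd : HasDim F 2) {v : E}
    (hv : v ∈ vertices F) : IsFacialCycle P (facialGraph P F) := by
  have hFpoly := hP.of_isFace hF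
  have := hP.finite_vertices.to_subtype
  have hsub : ∀ {x}, x ∈ vertices F → x ∈ vertices P := fun hx => mem_vertices_of_isFace hP hF hx
  refine ⟨?_, F, hF, hd, fun _ _ => Iff.rfl⟩
  have hcyc : (facialGraph P F).IsCycles := by
    rintro x ⟨y, hxy⟩
    obtain ⟨w, w', hne, hw, hw', hz, -⟩ := hd.exists_neighbors hFpoly (v := x) hxy.2.1
    rw [Set.ncard_eq_two]
    refine ⟨⟨w, hsub hw.2.2.1⟩, ⟨w', hsub hw'.2.2.1⟩, by simpa using hne, ?_⟩
    ext z
    simp only [Set.mem_insert_iff, Set.mem_singleton_iff, Subtype.ext_iff]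
    refine ⟨fun h => hz z h, ?_⟩
    rintro (h | h)
    · exact show JoinedByEdge F x z from h ▸ hw
    · exact show JoinedByEdge F x z from h ▸ hw'
  -- Connectedness follows by descending along `l` to the lowest vertex `u`. If no neighbour of `x`
  -- were lower, the cone at `x` would place `u` no lower than `x`.
  obtain ⟨l, hl⟩ := exists_injOn_functional hP.finite_vertices
  obtain ⟨u, hu, hmin⟩ := Set.exists_min_image (vertices F) l hFpoly.finite_vertices ⟨v, hv⟩
  have hdesc : ∀ x : vertices P, x.1 ∈ vertices F → x.1 ≠ u →
      ∃ y, (facialGraph P F).Adj x y ∧ l y < l x := by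
    intro x hx hxu
    have hlt : l u < l x := lt_of_le_of_ne (hmin x hx) fun h => hxu (hl (hsub hu) x.2 h).symm
    obtain ⟨w, w', -, hw, hw', -, hcone⟩ := hd.exists_neighbors hFpoly hx
    obtain ⟨a, b, ha, hb, hab⟩ := hcone u (mem_of_mem_vertices hu)
    have h1 := congrArg l hab
    simp only [map_add, map_smul, map_sub, smul_eq_mul] at h1
    by_contra! hcon
    have h2 := hcon ⟨w, hsub hw.2.2.1⟩ hw
    have h3 := hcon ⟨w', hsub hw'.2.2.1⟩ hw'
    have h4 := mul_nonneg ha (sub_nonneg.2 h2)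
    have h5 := mul_nonneg hb (sub_nonneg.2 h3)
    simp only at h4 h5
    linarith
  obtain ⟨w, -, -, hw, -⟩ := hd.exists_neighbors hFpoly hu
  refine isCycleOf_of_isCycles (fun x y h => JoinedByEdge.of_isFace hP hF h) hcyc
    (u := ⟨u, hsub hu⟩) ⟨⟨w, hsub hw.2.2.1⟩, hw⟩ fun x y hxy => ?_
  obtain ⟨z, ⟨hz, hzF⟩, hzmin⟩ := Set.exists_min_image
    {z : vertices P | (facialGraph P F).Reachable x z ∧ z.1 ∈ vertices F} (fun z => l z)
    (Set.toFinite _) ⟨x, SimpleGraph.Reachable.refl _, hxy.2.1⟩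
  by_cases hzu : z.1 = u
  · have : z = ⟨u, hsub hu⟩ := Subtype.ext hzu
    exact this ▸ hz.symm
  · obtain ⟨y', hzy', hlt⟩ := hdesc z hzF hzu
    exact absurd (hzmin y' ⟨hz.trans hzy'.reachable, hzy'.2.2.1⟩) (not_le.2 hlt)

end FacialCycles

/-! ### The generic sweep and the induction. -/

section Sweep

variable {E : Type*} [AddCommGroup E] [Module ℝ E] {P F : Set E} {v w y : E}

/-- The slope of `l` along the ray from `v` through `w`, measured against the descent of `h`. -/
noncomputable def slope (l h : E →ₗ[ℝ] ℝ) (v w : E) : ℝ :=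
  (l w - l v) / (h v - h w)

/-- There is a functional separating the vertices of a polytope, and the edges at each vertex. -/
lemma exists_generic_functional (hP : IsPolytope P) {h : E → E →ₗ[ℝ] ℝ}
    (hh : ∀ v ∈ vertices P, ∀ x ∈ P, x ≠ v → h v x < h v v) :
    ∃ l : E →ₗ[ℝ] ℝ, Set.InjOn l (vertices P) ∧ ∀ v w w', JoinedByEdge P v w →
      JoinedByEdge P v w' → slope l (h v) v w = slope l (h v) v w' → w = w' := by
  have := hP.finite_vertices.to_subtype
  -- The edge direction scaled so that `h v` takes the value -1 on it; the slope is then `l (r v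
  -- w)`. Distinct edges at `v` have distinct `r`, so a generic `l` separates them.
  let r : E → E → E := fun v w => (h v v - h v w)⁻¹ • (w - v)
  have hr : ∀ v w w', JoinedByEdge P v w → JoinedByEdge P v w' → r v w = r v w' → w = w' := by
    intro v w w' hw hw' heq
    obtain ⟨hne, hv, hwP, e, he, hde, hve, hwe⟩ := hw
    obtain ⟨k, hk, rfl⟩ := he.exists_functional hve
    have h1 := congrArg k heq
    have hkw : k w = k v := hwe.2
    have hw'P := mem_of_mem_vertices hw'.2.2.1
    have h2 := hh v hv w' hw'P hw'.1.symm
    simp only [r, map_smul, map_sub, smul_eq_mul, hkw, sub_self, mul_zero] at h1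
    have h3 : k w' - k v = 0 :=
      (mul_eq_zero.1 h1.symm).resolve_left (inv_ne_zero (by linarith))
    have := hde.eq_or_eq_of_isFace he hv hve hwP hwe hne.symm hw'.2.2.1 ⟨hw'P, by linarith⟩
    exact (this.resolve_left hw'.1.symm).symm
  obtain ⟨l, hl⟩ := Module.exists_dual_forall_apply_ne_zero (K := ℝ)
    (Sum.elim (fun i : {i : vertices P × vertices P // i.1 ≠ i.2} => (i.1.1 - i.1.2 : E))
      (fun i : {i : vertices P × vertices P × vertices P //
        r i.1 i.2.1 ≠ r i.1 i.2.2} => r i.1.1 i.1.2.1 - r i.1.1 i.1.2.2)) (by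
      rintro (i | i)
      · simpa [sub_eq_zero, Subtype.val_inj] using i.2
      · simpa [sub_eq_zero] using i.2)
  refine ⟨l, fun v hv w hw hvw => ?_, fun v w w' hw hw' hs => hr v w w' hw hw' ?_⟩
  · by_contra hne
    exact hl (Sum.inl ⟨(⟨v, hv⟩, ⟨w, hw⟩), by simpa using hne⟩) (by simp [hvw])
  · by_contra hne
    refine hl (Sum.inr ⟨(⟨v, hw.2.1⟩, ⟨w, hw.2.2.1⟩, ⟨w', hw'.2.2.1⟩), hne⟩) ?_
    simp only [slope, div_eq_inv_mul] at hs
    simp [r, hs]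

variable [FiniteDimensional ℝ E]

/-- If a descending edge `[v, w]` does not have minimal slope at `v`, it lies on a `2`-face with
top vertex `v` on which the other edge at `v` has smaller slope. -/
lemma exists_two_face_descending (hP : IsPolytope P) {l h : E →ₗ[ℝ] ℝ}
    (hh : ∀ x ∈ P, x ≠ v → h x < h v) (hw : JoinedByEdge P v w) (hlw : l w < l v)
    (hy : y ∈ P) (hyv : y ≠ v) (hs : slope l h v y < slope l h v w) :
    ∃ F, IsFace P F ∧ HasDim F 2 ∧ JoinedByEdge F v w ∧ (∀ x ∈ F, x ≠ v → l x < l v) ∧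
      ∀ z, JoinedByEdge F v z → z ≠ w → slope l h v z < slope l h v w := by
  obtain ⟨hne, hv, hwv, e, he, hde, hve, hwe⟩ := hw
  have hwP := mem_of_mem_vertices hwv
  -- For `s` the slope of `[v, w]`, the functional `l + s • h` is constant on that edge, and smaller
  -- slope means a smaller value than at `v`.
  have hslope : ∀ x ∈ P, x ≠ v → ∀ s, slope l h v x < s ↔ (l + s • h) x < (l + s • h) v := by
    intro x hx hxv s
    have := hh x hx hxv
    rw [slope, div_lt_iff₀ (by linarith)]
    simp only [LinearMap.add_apply, LinearMap.smul_apply, smul_eq_mul]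
    exact ⟨fun h => by linarith, fun h => by linarith⟩
  have hhw := hh w hwP hne.symm
  set s := slope l h v w with hsdef
  -- Negativity of `s` makes the second edge of `F` at `v` descend too; the cone then puts `v` on
  -- top of `F`.
  have hs0 : s < 0 := div_neg_of_neg_of_pos (by linarith) (by linarith)
  have hg : ∀ x ∈ e, (l + s • h) x = (l + s • h) v := by
    intro x hx
    obtain ⟨c, hc⟩ := hde.exists_smul_eq hve hwe hne.symm hx
    have h1 := congrArg (l + s • h) hc
    have h2 : (l + s • h) (w - v) = 0 := by
      have : s * (h v - h w) = l w - l v := div_mul_cancel₀ _ (by linarith)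
      simp only [LinearMap.add_apply, LinearMap.smul_apply, smul_eq_mul, map_sub]
      linarith
    rw [map_smul, h2, smul_zero, map_sub, sub_eq_zero] at h1
    exact h1
  obtain ⟨F, hF, hdF, heF, hlt⟩ :=
    exists_two_face_of_lt hP he hde hve hg hy ((hslope y hy hyv s).1 hs)
  have hvF := mem_vertices_of_subset hv (heF hve) hF.subset
  have hwF := mem_vertices_of_subset hwv (heF hwe) hF.subset
  have heF' := he.of_subset heF hF.subset
  obtain ⟨w', hw'e, hvw', hz, hcone⟩ :=
    hdF.exists_other_edge (hP.of_isFace hF) hvF heF' hde hve hwF hwe hne.symm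
  have hw'F := mem_of_mem_vertices hvw'.2.2.1
  have hw's : slope l h v w' < s :=
    (hslope w' (hF.subset hw'F) hvw'.1.symm s).2 (hlt w' hw'F hw'e)
  have hlw' : l w' < l v := by
    have h1 := hh w' (hF.subset hw'F) hvw'.1.symm
    have h2 := hw's.trans hs0
    rw [slope, div_lt_iff₀ (by linarith)] at h2
    linarith
  refine ⟨F, hF, hdF, ⟨hne, hvF, hwF, e, heF', hde, hve, hwe⟩, ?_, ?_⟩
  · intro x hx hxv
    obtain ⟨a, b, ha, hb, hab⟩ := hcone x hx
    have h1 := congrArg l hab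
    simp only [map_add, map_smul, map_sub, smul_eq_mul] at h1
    rcases ha.eq_or_lt with rfl | ha
    · rcases hb.eq_or_lt with rfl | hb
      · exact absurd (by simpa [sub_eq_zero] using hab) hxv
      · have := mul_pos hb (sub_pos.2 hlw')
        linarith
    · have h2 := mul_pos ha (sub_pos.2 hlw)
      have h3 := mul_nonneg hb (sub_nonneg.2 hlw'.le)
      linarith
  · intro z hvz hzw
    rwa [(hz z hvz).resolve_left hzw]

/-- Every even subgraph of the graph of a polytope is a symmetric difference of facial cycles. -/
theorem IsEvenSubgraph.isSymmDiffOfFacialCycles (hP : IsPolytope P)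
    {H : SimpleGraph (vertices P)} (hH : IsEvenSubgraph (graph P) H) :
    IsSymmDiffOfFacialCycles P H := by
  have := hP.finite_vertices.to_subtype
  have : ∀ v, ∃ h : E →ₗ[ℝ] ℝ, v ∈ vertices P → ∀ x ∈ P, x ≠ v → h x < h v := fun v => by
    by_cases hv : v ∈ vertices P
    · obtain ⟨h, hh⟩ := exists_functional_of_mem_vertices hv
      exact ⟨h, fun _ => hh⟩
    · exact ⟨0, fun h => absurd h hv⟩
  choose h hh using this
  obtain ⟨l, hl, hs⟩ := exists_generic_functional hP hh
  let φ : vertices P → vertices P → ℝ ×ₗ ℝ := fun v w => toLex (l v, slope l (h v) v w)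
  -- All pairs with key at most that of some descending edge of `H`: the cardinality is a
  -- natural-number rank of the largest key.
  let D : SimpleGraph (vertices P) → Set (vertices P × vertices P) := fun H =>
    {p | ∃ c d, H.Adj c d ∧ l d < l c ∧ φ p.1 p.2 ≤ φ c d}
  induction hn : (D H).ncard using Nat.strong_induction_on generalizing H with
  | _ n ih =>
  have hdart : ∀ {a b : vertices P}, a ≠ b → l b < l a ∨ l a < l b := fun {a b} hab => by
    rcases lt_trichotomy (l a) (l b) with h | h | h
    · exact Or.inr h
    · exact absurd (Subtype.ext (hl a.2 b.2 h)) hab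
    · exact Or.inl h
  by_cases hbot : H = ⊥
  · exact ⟨[], by simp, hbot⟩
  obtain ⟨⟨v, w⟩, ⟨hvw, hlvw⟩, hmax⟩ := Set.exists_max_image
    {p : vertices P × vertices P | H.Adj p.1 p.2 ∧ l p.2 < l p.1} (fun p => φ p.1 p.2)
    (Set.toFinite _) (by
      obtain ⟨a, b, hab⟩ := SimpleGraph.ne_bot_iff_exists_adj.1 hbot
      rcases hdart hab.ne with h | h
      · exact ⟨(a, b), hab, h⟩
      · exact ⟨(b, a), hab.symm, h⟩)
  simp only at hvw hlvw
  obtain ⟨w₂, hvw₂, hne⟩ : ∃ w₂, H.Adj v w₂ ∧ w₂ ≠ w := by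
    by_contra! hcon
    have hsing : H.neighborSet v = {w} := by
      ext x
      exact ⟨fun hx => hcon x hx, fun hx => by rw [hx]; exact hvw⟩
    have := hH.2 v
    rw [hsing, Set.ncard_singleton] at this
    exact absurd this (by decide)
  -- Otherwise `[w₂, v]` would descend from a higher vertex, contradicting maximality.
  have hlw₂ : l w₂ < l v := by
    rcases hdart hvw₂.ne with h | h
    · exact h
    · have := hmax (w₂, v) ⟨hvw₂.symm, h⟩
      rw [Prod.Lex.toLex_le_toLex] at this
      rcases this with h' | h'
      · exact absurd h' h.not_gt
      · exact absurd h'.1 h.ne'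
  have hslt : slope l (h v) v w₂ < slope l (h v) v w := by
    have := hmax (v, w₂) ⟨hvw₂, hlw₂⟩
    rw [Prod.Lex.toLex_le_toLex] at this
    rcases this with h' | h'
    · exact absurd h' (lt_irrefl _)
    · exact lt_of_le_of_ne h'.2 fun h => hne (Subtype.ext (hs v w₂ w (hH.1 hvw₂) (hH.1 hvw) h))
  obtain ⟨F, hF, hdF, hFvw, htop, hFs⟩ := exists_two_face_descending hP (hh v v.2) (hH.1 hvw) hlvw
    (mem_of_mem_vertices w₂.2) (fun h => hvw₂.ne (Subtype.ext h).symm) hslt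
  have hC := isFacialCycle_facialGraph hP hF hdF hFvw.2.1
  set C := facialGraph P F with hCdef
  -- An edge of `H` with the maximal key is `[v, w]` by genericity, and it cancels. A new edge comes
  -- from `F`: it starts below `v`, or at `v` with smaller slope.
  have hlt : ∀ c d, (H ∆ C).Adj c d → l d < l c → φ c d < φ v w := by
    intro c d hcd hdc
    rw [symmDiff_adj] at hcd
    by_cases hHcd : H.Adj c d
    · refine lt_of_le_of_ne (hmax (c, d) ⟨hHcd, hdc⟩) fun heq => hcd (iff_of_true hHcd ?_)
      have heq' := toLex.injective heq
      rw [Prod.mk.injEq] at heq'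
      obtain rfl : c = v := Subtype.ext (hl c.2 v.2 heq'.1)
      obtain rfl : d = w := Subtype.ext (hs c d w (hH.1 hHcd) (hH.1 hvw) heq'.2)
      exact hFvw
    · have hCcd : JoinedByEdge F c d := by
        by_contra h
        exact hcd (iff_of_false hHcd h)
      rw [Prod.Lex.toLex_lt_toLex]
      by_cases hcv : c = v
      · subst hcv
        refine Or.inr ⟨rfl, hFs d hCcd fun hdw => hHcd ?_⟩
        rwa [show d = w from Subtype.ext hdw]
      · exact Or.inl (htop c (mem_of_mem_vertices hCcd.2.1) fun h => hcv (Subtype.ext h))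
  have hssub : D (H ∆ C) ⊂ D H := by
    rw [Set.ssubset_iff_of_subset]
    · refine ⟨(v, w), ⟨v, w, hvw, hlvw, le_rfl⟩, ?_⟩
      rintro ⟨c, d, hcd, hdc, hle⟩
      exact absurd (hlt c d hcd hdc) (not_lt.2 hle)
    · rintro p ⟨c, d, hcd, hdc, hle⟩
      exact ⟨v, w, hvw, hlvw, hle.trans (hlt c d hcd hdc).le⟩
  obtain ⟨L, hL, hLeq⟩ := ih _ (hn ▸ Set.ncard_lt_ncard hssub (Set.toFinite _))
    (hH.symmDiff hC.1.isEvenSubgraph) rfl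
  refine ⟨C :: L, ?_, ?_⟩
  · simpa using ⟨hC, hL⟩
  · rw [List.foldr_cons, ← hLeq, symmDiff_comm H C, symmDiff_symmDiff_cancel_left]

end Sweep

end Polytope

theorem theorem1 (n d : ℕ) (hd : 2 ≤ d) (P : Set (EuclideanSpace ℝ (Fin n)))
    (hP : Polytope.IsPolytope P) (hdim : Polytope.HasDim P d) :
    (∀ H : SimpleGraph (Polytope.vertices P),
      Polytope.IsEvenSubgraph (Polytope.graph P) H → Polytope.IsSymmDiffOfFacialCycles P H) ∧
    (∀ C : SimpleGraph (Polytope.vertices P),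
      Polytope.IsCycleOf (Polytope.graph P) C → Polytope.IsSymmDiffOfFacialCycles P C) :=
  ⟨fun _ hH => hH.isSymmDiffOfFacialCycles hP,
    fun _ hC => hC.isEvenSubgraph.isSymmDiffOfFacialCycles hP⟩
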